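/- Let $U(L(sl_2))$ be the enveloping algebra over $\mathbb{C}$ of the $sl_2$ loop algebra, with generators $x_k^{\pm}, h_k$ ($k\in\mathbb{Z}$) satisfying $[h_j,x_k^{\pm}]=\pm 2x_{j+k}^{\pm}$, $[x_j^{+},x_k^{-}]=h_{j+k}$, $[h_j,h_k]=0$, $[x_j^{\pm},x_k^{\pm}]=0$. Let $U(B)$ be the subalgebra generated by $h_0, x_0^{+}, x_1^{-}$; it contains $h_k, x_k^{+}$ for $k\ge 0$ and $x_k^{-}$ for $k\ge 1$. Let $\Psi\neq 0$ be a vector of a $U(B)$-module with $x_k^{+}\Psi=0$ and $h_k\Psi=d_k\Psi$ for all $k\ge 0$ ($d_k\in\mathbb{C}$), and assume that $V_B=U(B)\Psi$ is finite-dimensional over $\mathbb{C}$. Let $r\ge 0$ be the degree of nilpotency of $x_1^{-}$ in $V_B$, i.e. $(x_1^{-})^{r+1}\Psi=0$ and $(x_1^{-})^{j}\Psi\ne 0$ for $0<j\le r$. Let $\lambda_k\in\mathbb{C}$ be the eigenvalue defined by $\frac{(x_0^{+})^k}{k!}\frac{(x_1^{-})^k}{k!}\Psi=\lambda_k\Psi$,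 and put $P_\Psi(u)=\sum_{k=0}^{r}\lambda_k(-u)^k$. The evaluation parameters of $\Psi$ are pairwise different $a_1,\dots,a_s\in\mathbb{C}$, with multiplicities $m_1,\dots,m_s\ge 1$, such that $P_\Psi(u)=\prod_{k=1}^{s}(1-a_ku)^{m_k}$ and $m_1+\dots+m_s=r$. For a multiset $A$ of $m$ complex parameters let $x_m^{-}(A)=\sum_{k=0}^{m}(-1)^k e_k(A)\,x_{m-k}^{-}$, where $e_k$ is the $k$-th elementary symmetric function, and for $1\le j\le s$ let $\rho_j^{-}(\boldsymbol{a}^{(1)})=x_s^{-}(A_j^{(1)})$ with $A_j^{(1)}=\{a_1,\dots,a_s\}\setminus\{a_j\}\cup\{0\}$ (multiset union); the coefficient of $x_0^{-}$ is zero, so this is an element of $U(B)$. If the evaluation parameters, counted with multiplicity, are distinct, i.e. $m_k=1$ for all $k$ (so $s=r$), then for every integer $n\ge 0$ the vectors $\prod_{t=1}^{n}\rho_{j_t}^{-}(\boldsymbol{a}^{(1)})\,\Psi$, indexed by $1\le j_1<\dots<j_n\le s$, form a basis of the sector $\{v\in V_B : h_0v=(d_0-2n)v\}$. -/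

import Mathlib

open scoped TensorProduct Nat

noncomputable section

namespace BorelLoop

/-- The Lie algebra `sl₂` over `ℂ`. -/
abbrev Sl2 := LieAlgebra.SpecialLinear.sl (Fin 2) ℂ

/-- The `sl₂` loop algebra `L(sl₂) = ℂ[t, t⁻¹] ⊗ sl₂`. -/
abbrev LoopSl2 := LieAlgebra.loopAlgebra ℂ ℤ Sl2

/-- The enveloping algebra `U(L(sl₂))`. -/
abbrev ULoop := UniversalEnvelopingAlgebra ℂ LoopSl2

/-- The standard raising matrix of `sl₂`. -/
def matE : Sl2 := LieAlgebra.SpecialLinear.single (0 : Fin 2) 1 (by decide) (1 : ℂ)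

/-- The standard lowering matrix of `sl₂`. -/
def matF : Sl2 := LieAlgebra.SpecialLinear.single (1 : Fin 2) 0 (by decide) (1 : ℂ)

/-- The diagonal matrix `diag(1, -1)` of `sl₂`. -/
def matH : Sl2 := LieAlgebra.SpecialLinear.singleSubSingle (0 : Fin 2) 1 (1 : ℂ)

/-- The image in `U(L(sl₂))` of `t ^ k ⊗ y`. -/
def loopGen (y : Sl2) (k : ℤ) : ULoop :=
  UniversalEnvelopingAlgebra.ι ℂ
    ((AddMonoidAlgebra.single k (1 : ℂ) ⊗ₜ[ℂ] y : LoopSl2))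

/-- The Drinfeld generator `x_k⁺` (`k ∈ ℤ`) of `U(L(sl₂))`. -/
def xPlus (k : ℤ) : ULoop := loopGen matE k

/-- The Drinfeld generator `x_k⁻`. -/
def xMinus (k : ℤ) : ULoop := loopGen matF k

/-- The Drinfeld generator `h_k`. -/
def hGen (k : ℤ) : ULoop := loopGen matH k

/-- The Borel subalgebra `U(B)`: the subalgebra of `U(L(sl₂))` generated by `h_0`, `x_0⁺` and
`x_1⁻`. -/
def UB : Subalgebra ℂ ULoop := Algebra.adjoin ℂ {hGen 0, xPlus 0, xMinus 1}

/-! The defining relations of the generators. -/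

theorem lie_matE_matF : ⁅matE, matF⁆ = matH := by
  apply Subtype.ext
  rw [LieAlgebra.SpecialLinear.sl_bracket]
  ext i j
  fin_cases i <;> fin_cases j <;> simp [matE, matF, matH]

theorem lie_matH_matE : ⁅matH, matE⁆ = (2 : ℂ) • matE := by
  apply Subtype.ext
  rw [LieAlgebra.SpecialLinear.sl_bracket]
  ext i j
  fin_cases i <;> fin_cases j <;> simp [matE, matH, Matrix.sub_mul, Matrix.mul_sub] <;> norm_num

theorem lie_matH_matF : ⁅matH, matF⁆ = (-2 : ℂ) • matF := by
  apply Subtype.ext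
  rw [LieAlgebra.SpecialLinear.sl_bracket]
  ext i j
  fin_cases i <;> fin_cases j <;> simp [matF, matH, Matrix.sub_mul, Matrix.mul_sub] <;> norm_num

section

attribute [local instance 100] LieRing.ofAssociativeRing

theorem loopGen_comm (y z : Sl2) (j k : ℤ) :
    loopGen y j * loopGen z k - loopGen z k * loopGen y j = loopGen ⁅y, z⁆ (j + k) := by
  rw [← LieRing.of_associative_ring_bracket, loopGen, loopGen, ← LieHom.map_lie,
    LieAlgebra.ExtendScalars.bracket_tmul, AddMonoidAlgebra.single_mul_single, one_mul, loopGen]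

theorem loopGen_smul (c : ℂ) (y : Sl2) (k : ℤ) : loopGen (c • y) k = c • loopGen y k := by
  rw [loopGen, TensorProduct.tmul_smul, map_smul, loopGen]

theorem loopGen_zero (k : ℤ) : loopGen 0 k = 0 := by
  rw [loopGen, TensorProduct.tmul_zero, map_zero]

end

theorem xPlus_xMinus_comm (j k : ℤ) :
    xPlus j * xMinus k - xMinus k * xPlus j = hGen (j + k) := by
  rw [xPlus, xMinus, loopGen_comm, lie_matE_matF, hGen]

theorem hGen_xPlus_comm (j k : ℤ) :
    hGen j * xPlus k - xPlus k * hGen j = (2 : ℂ) • xPlus (j + k) := by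
  rw [xPlus, hGen, loopGen_comm, lie_matH_matE, loopGen_smul, xPlus]

theorem hGen_xMinus_comm (j k : ℤ) :
    hGen j * xMinus k - xMinus k * hGen j = (-2 : ℂ) • xMinus (j + k) := by
  rw [xMinus, hGen, loopGen_comm, lie_matH_matF, loopGen_smul, xMinus]

theorem hGen_comm (j k : ℤ) : hGen j * hGen k - hGen k * hGen j = 0 := by
  rw [hGen, hGen, loopGen_comm, lie_self, loopGen_zero]

theorem xPlus_comm (j k : ℤ) : xPlus j * xPlus k - xPlus k * xPlus j = 0 := by
  rw [xPlus, xPlus, loopGen_comm, lie_self, loopGen_zero]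

theorem xMinus_comm (j k : ℤ) : xMinus j * xMinus k - xMinus k * xMinus j = 0 := by
  rw [xMinus, xMinus, loopGen_comm, lie_self, loopGen_zero]

/-! The generators `h_k`, `x_k⁺` (`k ≥ 0`) and `x_k⁻` (`k ≥ 1`) lie in `U(B)`. -/

theorem xPlus_zero_mem : xPlus 0 ∈ UB := Algebra.subset_adjoin (by simp)

theorem hGen_zero_mem : hGen 0 ∈ UB := Algebra.subset_adjoin (by simp)

theorem xMinus_one_mem : xMinus 1 ∈ UB := Algebra.subset_adjoin (by simp)

theorem xMinus_mem_succ (n : ℕ) (hh : hGen 1 ∈ UB) : xMinus ((n : ℤ) + 1) ∈ UB := by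
  induction n with
  | zero => simpa using xMinus_one_mem
  | succ n ih =>
    have h1 := hGen_xMinus_comm 1 ((n : ℤ) + 1)
    have h2 : xMinus (((n + 1 : ℕ) : ℤ) + 1) = (-2 : ℂ)⁻¹ •
        (hGen 1 * xMinus ((n : ℤ) + 1) - xMinus ((n : ℤ) + 1) * hGen 1) := by
      rw [h1, smul_smul, inv_mul_cancel₀ (by norm_num), one_smul]
      congr 1
      push_cast
      ring
    rw [h2]
    exact UB.smul_mem (sub_mem (mul_mem hh ih) (mul_mem ih hh)) _

theorem hGen_one_mem : hGen 1 ∈ UB := by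
  have h := xPlus_xMinus_comm 0 1
  rw [zero_add] at h
  rw [← h]
  exact sub_mem (mul_mem xPlus_zero_mem xMinus_one_mem) (mul_mem xMinus_one_mem xPlus_zero_mem)

theorem xMinus_mem (k : ℕ) (hk : 1 ≤ k) : xMinus k ∈ UB := by
  obtain ⟨n, rfl⟩ := Nat.exists_eq_add_of_le' hk
  simpa using xMinus_mem_succ n hGen_one_mem

theorem xPlus_mem (k : ℕ) : xPlus k ∈ UB := by
  induction k with
  | zero => simpa using xPlus_zero_mem
  | succ n ih =>
    have h1 := hGen_xPlus_comm 1 (n : ℤ)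
    have h2 : xPlus ((n + 1 : ℕ) : ℤ) = (2 : ℂ)⁻¹ •
        (hGen 1 * xPlus (n : ℤ) - xPlus (n : ℤ) * hGen 1) := by
      rw [h1, smul_smul, inv_mul_cancel₀ (by norm_num), one_smul]
      congr 1
      push_cast
      ring
    rw [h2]
    exact UB.smul_mem (sub_mem (mul_mem hGen_one_mem ih) (mul_mem ih hGen_one_mem)) _

theorem hGen_mem (k : ℕ) : hGen k ∈ UB := by
  rcases Nat.eq_zero_or_pos k with rfl | hk
  · simpa using hGen_zero_mem
  · have h := xPlus_xMinus_comm 0 (k : ℤ)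
    rw [zero_add] at h
    rw [← h]
    exact sub_mem (mul_mem xPlus_zero_mem (xMinus_mem k hk))
      (mul_mem (xMinus_mem k hk) xPlus_zero_mem)

/-- `x_k⁺` (`k ≥ 0`) as an element of `U(B)`. -/
def bxPlus (k : ℕ) : UB := ⟨xPlus k, xPlus_mem k⟩

/-- `h_k` (`k ≥ 0`) as an element of `U(B)`. -/
def bh (k : ℕ) : UB := ⟨hGen k, hGen_mem k⟩

/-- `x_1⁻` as an element of `U(B)`. -/
def bxMinusOne : UB := ⟨xMinus 1, xMinus_one_mem⟩

/-- The generator with parameters `x_m⁻(A)`, where `A` is a multiset of `m` parameters: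
`∑_{k=0}^m (-1)^k e_k(A) x_{m-k}⁻` with `e_k` the elementary symmetric functions. -/
def xMinusParam (A : Multiset ℂ) : ULoop :=
  ∑ k ∈ Finset.range (Multiset.card A + 1),
    ((-1 : ℂ) ^ k * A.esymm k) • xMinus ((Multiset.card A : ℤ) - k)

/-- If `0` is among the parameters, then `x_m⁻(A)` does not involve `x_0⁻` and lies in `U(B)`. -/
theorem xMinusParam_mem (A : Multiset ℂ) (hA : (0 : ℂ) ∈ A) : xMinusParam A ∈ UB := by
  refine sum_mem fun k hk => ?_
  rcases Nat.lt_or_ge k (Multiset.card A) with h | h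
  · have h2 : ((Multiset.card A : ℤ) - k) = ((Multiset.card A - k : ℕ) : ℤ) := by omega
    rw [h2]
    exact UB.smul_mem (xMinus_mem _ (by omega)) _
  · have h3 : k = Multiset.card A := by
      have := Finset.mem_range.1 hk
      omega
    have h4 : A.esymm k = 0 := by
      subst h3
      simp [Multiset.esymm, Multiset.powersetCard_self, Multiset.prod_eq_zero hA]
    rw [h4, mul_zero, zero_smul]
    exact zero_mem _

/-- The multiset `A_j⁽¹⁾ = {α_1, …, α_s} ∖ {α_j} ∪ {0}`. -/
def paramsWithout {s : ℕ} (α : Fin s → ℂ) (j : Fin s) : Multiset ℂ :=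
  0 ::ₘ ((Finset.univ.erase j).val.map α)

/-- `ρ_j⁻(α⁽¹⁾) = x_s⁻(A_j⁽¹⁾)`, an element of `U(B)`. -/
def rhoMinus {s : ℕ} (α : Fin s → ℂ) (j : Fin s) : UB :=
  ⟨xMinusParam (paramsWithout α j), xMinusParam_mem _ (Multiset.mem_cons_self _ _)⟩

/-- The divided power `X⁽ⁿ⁾ = Xⁿ / n!`. -/
def dividedPow (X : UB) (n : ℕ) : UB := ((n ! : ℂ)⁻¹) • X ^ n

variable {V : Type*} [AddCommGroup V] [Module ℂ V] [Module UB V] [IsScalarTower ℂ UB V]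

/-- `Ψ` is a highest weight vector of `U(B)` with highest weight `(d_k)`. -/
structure IsHighestWeightVector (d : ℕ → ℂ) (Ψ : V) : Prop where
  ne_zero : Ψ ≠ 0
  xPlus_smul : ∀ k : ℕ, bxPlus k • Ψ = 0
  h_smul : ∀ k : ℕ, bh k • Ψ = d k • Ψ

/-- The representation `V_B = U(B) Ψ` generated by `Ψ`, as a complex vector space. -/
def VB (Ψ : V) : Submodule ℂ V := (Submodule.span UB {Ψ}).restrictScalars ℂ

/-- The sector `h_0 = d_0 - 2n` of `V_B`. -/
def sector (Ψ : V) (d₀ : ℂ) (n : ℕ) : Submodule ℂ V where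
  carrier := {v | v ∈ VB Ψ ∧ bh 0 • v = (d₀ - 2 * (n : ℂ)) • v}
  zero_mem' := ⟨zero_mem _, by rw [smul_zero, smul_zero]⟩
  add_mem' := fun ha hb => ⟨add_mem ha.1 hb.1, by rw [smul_add, smul_add, ha.2, hb.2]⟩
  smul_mem' := fun c v hv => ⟨(VB Ψ).smul_mem c hv.1, by
    rw [← algebraMap_smul UB c v, smul_smul, ← Algebra.commutes, ← smul_smul, hv.2,
      algebraMap_smul, algebraMap_smul, smul_comm]⟩

/-- `x_1⁻` is nilpotent of degree `r` in `V_B = U(B) Ψ`. -/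
def IsNilpotentOfDegree (Ψ : V) (r : ℕ) : Prop :=
  bxMinusOne ^ (r + 1) • Ψ = 0 ∧ ∀ j : ℕ, 0 < j → j ≤ r → bxMinusOne ^ j • Ψ ≠ 0

open Classical in
/-- The eigenvalue `λ_k` of `(x_0⁺)⁽ᵏ⁾ (x_1⁻)⁽ᵏ⁾` on `Ψ` (with the value `0` if `Ψ` is not an
eigenvector, which does not happen for a highest weight vector). -/
def eigenvalue (Ψ : V) (k : ℕ) : ℂ :=
  if h : ∃ c : ℂ, (dividedPow (bxPlus 0) k * dividedPow bxMinusOne k) • Ψ = c • Ψ then h.choose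
  else 0

open Polynomial in
/-- The generalized Drinfeld polynomial `P_Ψ(u) = ∑_{k=0}^r λ_k (-u)^k`, where `r` is the degree
of nilpotency of `x_1⁻`. -/
def drinfeldPoly (Ψ : V) (r : ℕ) : ℂ[X] :=
  ∑ k ∈ Finset.range (r + 1), C (eigenvalue Ψ k) * (-X) ^ k

open Polynomial in
/-- `a_1, …, a_s` are the (pairwise different) evaluation parameters of `Ψ`, with multiplicities
`m_1, …, m_s ≥ 1`: `P_Ψ(u) = ∏_k (1 - a_k u)^{m_k}` and `m_1 + ⋯ + m_s = r`. The last condition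
fixes the multiplicity of a possible parameter `a_k = 0`, which the product does not see. -/
structure IsEvaluationParameters (Ψ : V) (r : ℕ) {s : ℕ} (a : Fin s → ℂ) (m : Fin s → ℕ) :
    Prop where
  injective : Function.Injective a
  mult_pos : ∀ k, 0 < m k
  sum_mult : ∑ k, m k = r
  factorization : drinfeldPoly Ψ r = ∏ k, (1 - C (a k) * X) ^ m k

end BorelLoop

end

/-! Write `F f` for x⁻(t f) and let f_j = ∏_{i ≠ j} (t - a_i), so that ρ_j⁻ = `F f_j`. The whole
structure follows from relations on Ψ that nilpotency of x_1⁻ forces. For Y(u) = ∑ (-u)ⁱ x⁻_{i+1}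
one has [x_0⁺, Y] = K and [K, Y] = 2Y'. If l is the series with l(0) = 1 whose logarithmic
derivative is the eigenvalue of K on Ψ, then x_0⁺ sends Y^{m+1} l Ψ to (m+1)(Y^m l)' Ψ. Iterating
(`e_pow_smul_F_one_pow`) makes (x_0⁺)ᵏ(x_1⁻)^{m+k} Ψ a nonzero multiple of the uᵏ-coefficient of Y^m
l Ψ. Three cases matter: m = 0: the coefficients of l are the λ_k, so l agrees with ∏ (1 + a_j u) up
to degree r. m = 1, k = r: `F` of ∏ (a_i - t) kills Ψ; hence `F f` Ψ depends only on the values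
f(a_i), and the ρ_j⁻ Ψ span all `F f` Ψ. m = 2, k = r - 1: partial fractions yield ∑ β_j (ρ_j⁻)² Ψ =
0 with all β_j nonzero, and the Cartan elements separate the terms (`F_sq_smul`).

With the squares zero on Ψ, the products over subsets S span V_B. The vector (x_1⁻)^r Ψ ≠ 0 is a
multiple of the product over all j, which is therefore nonzero; multiplying by complementary
products gives linear independence. Since h_0 has eigenvalue d_0 - 2|S| on the product over S, the
sector is cut out by |S| = n. -/

noncomputable section

namespace BorelLoop

open PowerSeries Finset

/-! ### Formal derivatives over noncommutative coefficients -/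

section CoeffDerivative

variable {A : Type*} [Ring A]

/-- The formal derivative of a power series with coefficients in a ring that need not be
commutative. -/
def psDeriv (f : A⟦X⟧) : A⟦X⟧ := PowerSeries.mk fun n => (n + 1) • coeff (n + 1) f

theorem coeff_psDeriv (f : A⟦X⟧) (n : ℕ) : coeff n (psDeriv f) = (n + 1) • coeff (n + 1) f :=
  coeff_mk _ _

theorem psDeriv_mul (f g : A⟦X⟧) : psDeriv (f * g) = psDeriv f * g + f * psDeriv g := by
  ext n
  have h : (n + 1) • coeff (n + 1) (f * g) =
      ∑ p ∈ antidiagonal (n + 1), p.1 • (coeff p.1 f * coeff p.2 g) +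
      ∑ p ∈ antidiagonal (n + 1), p.2 • (coeff p.1 f * coeff p.2 g) := by
    rw [coeff_mul, Finset.smul_sum, ← Finset.sum_add_distrib]
    refine Finset.sum_congr rfl fun p hp => ?_
    rw [← add_smul, mem_antidiagonal.1 hp]
  rw [coeff_psDeriv, h, Nat.sum_antidiagonal_succ, Nat.sum_antidiagonal_succ', map_add, coeff_mul,
    coeff_mul]
  simp only [zero_smul, zero_add, coeff_psDeriv, smul_mul_assoc, mul_smul_comm]

theorem commute_of_coeff {f g : A⟦X⟧} (h : ∀ i j, Commute (coeff i f) (coeff j g)) :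
    Commute f g := by
  ext n
  rw [coeff_mul, coeff_mul, ← Nat.sum_antidiagonal_swap]
  exact Finset.sum_congr rfl fun p _ => (h _ _).eq

/-- The power rule needs only that `f` commute with its derivative; the extra factor `f` avoids the
exponent `m - 1`. -/
theorem psDeriv_pow_mul {f : A⟦X⟧} (h : Commute f (psDeriv f)) (m : ℕ) :
    psDeriv (f ^ m) * f = m • (f ^ m * psDeriv f) := by
  induction m with
  | zero =>
    have : psDeriv (1 : A⟦X⟧) = 0 := by
      ext n
      simp [coeff_psDeriv, coeff_one]
    simp [this]
  | succ m ih =>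
    rw [pow_succ, psDeriv_mul, ih, add_mul, smul_mul_assoc, mul_assoc, ← h.eq, succ_nsmul, mul_assoc]

end CoeffDerivative

/-! ### Loop triples and series with prescribed logarithmic derivative -/

/-- Elements `e = x_0⁺`, `F f = x⁻(t f)` and `H f = h(f)` of an algebra, where `f` runs over the
polynomials in the loop variable, with the commutation relations of `U(B)`. -/
structure LoopTriple (A : Type*) [Ring A] [Algebra ℂ A] where
  e : A
  F : Polynomial ℂ →ₗ[ℂ] A
  H : Polynomial ℂ →ₗ[ℂ] A
  F_comm : ∀ f g, Commute (F f) (F g)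
  e_F : ∀ f, e * F f = F f * e + H (Polynomial.X * f)
  H_F : ∀ f g, H f * F g = F g * H f - (2 : ℂ) • F (f * g)

/-- `Ψ` is a highest weight vector of the triple `T`, with weight `δ`. -/
structure LoopTriple.IsHighest {A V : Type*} [Ring A] [Algebra ℂ A] [AddCommGroup V] [Module ℂ V]
    [Module A V] (T : LoopTriple A) (δ : Polynomial ℂ →ₗ[ℂ] ℂ) (Ψ : V) : Prop where
  e_smul : T.e • Ψ = 0
  H_smul : ∀ f, T.H f • Ψ = δ f • Ψ

/-- The coefficients of the power series `L` with `L 0 = 1` and `L' = D L`. -/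
def logSeriesCoeff (D : ℕ → ℂ) : ℕ → ℂ
  | 0 => 1
  | k + 1 => (∑ p : Fin (k + 1), D (k - p) * logSeriesCoeff D p) / (k + 1)

/-- The power series with constant coefficient `1` and logarithmic derivative `∑ D_n uⁿ`. -/
def logSeries (D : ℕ → ℂ) : ℂ⟦X⟧ := PowerSeries.mk (logSeriesCoeff D)

theorem psDeriv_logSeries (D : ℕ → ℂ) :
    psDeriv (logSeries D) = PowerSeries.mk D * logSeries D := by
  ext k
  rw [coeff_psDeriv, coeff_mul, ← Nat.sum_antidiagonal_swap,
    Nat.sum_antidiagonal_eq_sum_range_succ_mk, logSeries, coeff_mk, logSeriesCoeff,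
    Finset.sum_range]
  simp only [Prod.swap, coeff_mk, nsmul_eq_mul]
  push_cast
  field_simp

/-! ### Action of the raising operator on powers of Y -/

namespace LoopTriple

section

variable {A : Type*} [Ring A] [Algebra ℂ A] (T : LoopTriple A)

/-- The generating series `∑ (-u)ⁱ x⁻_{i+1}`. -/
def Y : A⟦X⟧ := PowerSeries.mk fun i => T.F ((-Polynomial.X) ^ i)

/-- The generating series `∑ (-u)ⁱ h_{i+1}`. -/
def K : A⟦X⟧ := PowerSeries.mk fun i => T.H (Polynomial.X * (-Polynomial.X) ^ i)

theorem C_e_mul_Y : C T.e * T.Y = T.Y * C T.e + T.K := by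
  ext n
  simp [Y, K, coeff_C_mul, coeff_mul_C, T.e_F]

theorem commute_Y_psDeriv : Commute T.Y (psDeriv T.Y) := by
  refine commute_of_coeff fun i j => ?_
  rw [coeff_psDeriv, Y, coeff_mk, coeff_mk]
  exact (T.F_comm _ _).smul_right _

/-- `H_F` sees only the product of its two polynomials, so all `n + 1` commutators in degree `n`
coincide; their number produces the derivative. -/
theorem K_mul_Y : T.K * T.Y = T.Y * T.K + 2 • psDeriv T.Y := by
  ext n
  rw [map_add, coeff_mul, coeff_mul, ← Nat.sum_antidiagonal_swap, map_nsmul, coeff_psDeriv]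
  have h : ∀ p ∈ antidiagonal n, coeff p.swap.1 T.K * coeff p.swap.2 T.Y =
      coeff p.1 T.Y * coeff p.2 T.K + (2 : ℂ) • T.F ((-Polynomial.X) ^ (n + 1)) := by
    intro p hp
    rw [← mem_antidiagonal.1 hp]
    simp only [Prod.swap, Y, K, coeff_mk, T.H_F]
    rw [sub_eq_add_neg, ← smul_neg, ← map_neg]
    congr 3
    ring
  rw [Finset.sum_congr rfl h, Finset.sum_add_distrib, Finset.sum_const, Nat.card_antidiagonal,
    smul_comm (n + 1), ofNat_smul_eq_nsmul, Y, coeff_mk]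

/-- Each passage of `e` through a factor leaves a K, and moving K to the right past j factors leaves
2j Y^{j-1} Y'. Summing over j ≤ m gives m(m+1) Y^{m-1} Y' = (m+1)(Y^m)'. -/
theorem C_e_mul_Y_pow (m : ℕ) :
    C T.e * T.Y ^ (m + 1) =
      T.Y ^ (m + 1) * C T.e + (m + 1) • (T.Y ^ m * T.K + psDeriv (T.Y ^ m)) := by
  induction m with
  | zero =>
    have h := psDeriv_mul (1 : A⟦X⟧) 1
    simp only [mul_one, one_mul, left_eq_add] at h
    simp [C_e_mul_Y, h]
  | succ m ih =>
    have h := psDeriv_pow_mul T.commute_Y_psDeriv m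
    rw [pow_succ _ (m + 1), ← mul_assoc, ih, add_mul, mul_assoc, C_e_mul_Y, smul_mul_assoc,
      add_mul, mul_assoc, K_mul_Y, h, pow_succ T.Y m, psDeriv_mul, h]
    simp only [mul_add, ← mul_assoc, ← pow_succ, smul_add, mul_smul_comm]
    module

end

section

variable {A : Type*} [Ring A] [Algebra ℂ A]

/-- A complex power series as a power series over a complex algebra. -/
abbrev psMap (A : Type*) [Ring A] [Algebra ℂ A] : ℂ⟦X⟧ →+* A⟦X⟧ :=
  PowerSeries.map (algebraMap ℂ A)

theorem commute_psMap (l : ℂ⟦X⟧) (f : A⟦X⟧) : Commute (psMap A l) f :=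
  commute_of_coeff fun i j => by
    rw [coeff_map]
    exact Algebra.commutes _ _

end

section

variable {A V : Type*} [Ring A] [AddCommGroup V] [Module A V]

/-- Two power series agree on `Ψ`. -/
def AgreeOn (Ψ : V) (f g : A⟦X⟧) : Prop := ∀ n, coeff n f • Ψ = coeff n g • Ψ

theorem AgreeOn.mul_left {Ψ : V} {f g : A⟦X⟧} (h : AgreeOn Ψ f g) (k : A⟦X⟧) :
    AgreeOn Ψ (k * f) (k * g) := by
  intro n
  rw [coeff_mul, coeff_mul, Finset.sum_smul, Finset.sum_smul]
  exact Finset.sum_congr rfl fun p _ => by rw [mul_smul, h, mul_smul]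

end

section

variable {A V : Type*} [Ring A] [Algebra ℂ A] [AddCommGroup V] [Module ℂ V] [Module A V]
  [IsScalarTower ℂ A V] {T : LoopTriple A} {δ : Polynomial ℂ →ₗ[ℂ] ℂ} {Ψ : V}

/-- The power series whose coefficients turn out to be the eigenvalues of
`(x_0⁺)⁽ᵏ⁾ (x_1⁻)⁽ᵏ⁾`. -/
def weightSeries (δ : Polynomial ℂ →ₗ[ℂ] ℂ) : ℂ⟦X⟧ :=
  logSeries fun i => δ (Polynomial.X * (-Polynomial.X) ^ i)

/-- The weight series l is an integrating factor: on Ψ the series K acts as D with l' = D l, so Y^m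
K + (Y^m)', multiplied by l, becomes the total derivative (Y^m l)'. -/
theorem e_smul_coeff (hΨ : T.IsHighest δ Ψ) (m i : ℕ) :
    T.e • coeff i (T.Y ^ (m + 1) * psMap A (weightSeries δ)) • Ψ =
      ((m + 1) * (i + 1)) • coeff (i + 1) (T.Y ^ m * psMap A (weightSeries δ)) • Ψ := by
  set l := psMap A (weightSeries δ) with hl
  set D := psMap A (PowerSeries.mk fun i => δ (Polynomial.X * (-Polynomial.X) ^ i)) with hD
  have hcomm : ∀ f : A⟦X⟧, Commute l f := commute_psMap _
  have h1 : AgreeOn Ψ (C T.e) 0 := fun n => by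
    rw [coeff_C]
    split_ifs <;> simp [hΨ.e_smul]
  have h2 : AgreeOn Ψ T.K D := fun n => by
    rw [K, coeff_mk, hΨ.H_smul, hD, coeff_map, coeff_mk, algebraMap_smul]
  have h3 : psDeriv l = D * l := by
    have h := congr_arg (psMap A) (psDeriv_logSeries
      fun i => δ (Polynomial.X * (-Polynomial.X) ^ i))
    rw [map_mul] at h
    rw [hl, hD, weightSeries, ← h]
    ext n
    simp [coeff_psDeriv]
  have h4 : C T.e * (T.Y ^ (m + 1) * l) = (T.Y ^ (m + 1) * l) * C T.e +
      (m + 1) • ((T.Y ^ m * l) * T.K + psDeriv (T.Y ^ m) * l) := by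
    rw [← mul_assoc, C_e_mul_Y_pow, add_mul, mul_assoc, ← (hcomm _).eq, mul_assoc, smul_mul_assoc,
      add_mul, mul_assoc (T.Y ^ m), ← (hcomm _).eq, mul_assoc]
  have h5 : psDeriv (T.Y ^ m * l) = (T.Y ^ m * l) * D + psDeriv (T.Y ^ m) * l := by
    rw [psDeriv_mul, h3, ← (hcomm D).eq, mul_assoc, add_comm]
  have h6 := h1.mul_left (T.Y ^ (m + 1) * l) i
  have h7 := h2.mul_left (T.Y ^ m * l) i
  have h8 := congr_arg (fun f => coeff i f • Ψ) h4
  have h9 := congr_arg (fun f => coeff i f • Ψ) h5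
  simp only [coeff_C_mul, map_add, map_nsmul, add_smul, mul_zero, map_zero, zero_smul,
    coeff_psDeriv, smul_assoc] at h6 h8 h9
  rw [← mul_smul, h8, h6, h7, ← h9, zero_add]
  generalize coeff (i + 1) (T.Y ^ m * l) • Ψ = x
  module

/-- Each application of `e` trades one factor Y for one derivative, so `m` must vary in the
induction; at `k = 0` only the constant term `F 1 ^ m` remains. -/
theorem e_pow_smul_F_one_pow (hΨ : T.IsHighest δ Ψ) (m k : ℕ) :
    (m.factorial : ℂ) • T.e ^ k • T.F 1 ^ (m + k) • Ψ = ((m + k).factorial * k.factorial : ℂ) •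
      coeff k (T.Y ^ m * psMap A (weightSeries δ)) • Ψ := by
  induction k generalizing m with
  | zero =>
    have h1 : constantCoeff (weightSeries δ) = 1 := by
      rw [← coeff_zero_eq_constantCoeff_apply, weightSeries, logSeries, coeff_mk, logSeriesCoeff]
    have h2 : constantCoeff T.Y = T.F 1 := by
      rw [← coeff_zero_eq_constantCoeff_apply, Y, coeff_mk, pow_zero]
    have h3 : constantCoeff (psMap A (weightSeries δ)) = 1 := by
      rw [← coeff_zero_eq_constantCoeff_apply, coeff_map, coeff_zero_eq_constantCoeff_apply, h1,
        map_one]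
    simp [h2, h3]
  | succ k ih =>
    have h := ih (m + 1)
    have h2 : ((m + 1 : ℕ) : ℂ) ≠ 0 := Nat.cast_ne_zero.2 m.succ_ne_zero
    have hc : ∀ (c : ℂ) (v : V), T.e • c • v = c • T.e • v := fun c v => smul_comm _ _ _
    have h3 := congr_arg (fun v => T.e • v) h
    simp only [hc, e_smul_coeff hΨ] at h3
    rw [← mul_smul, ← pow_succ', Nat.factorial_succ, Nat.cast_mul, mul_smul,
      ← Nat.cast_smul_eq_nsmul ℂ, Nat.cast_mul, mul_comm ((m + 1 : ℕ) : ℂ), smul_smul _ (_ * _),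
      show m + 1 + k = m + (k + 1) by ring, mul_comm _ ((m + 1 : ℕ) : ℂ),
      mul_left_comm, mul_smul ((m + 1 : ℕ) : ℂ)] at h3
    rw [smul_right_injective V h2 h3, Nat.factorial_succ k]
    congr 1
    push_cast
    ring

end

end LoopTriple

end BorelLoop

namespace BorelLoop

open PowerSeries Finset

/-! ### Coefficients of products of linear factors -/

section Coefficients

variable {R ι : Type*} [CommRing R] [DecidableEq ι]

theorem coeff_succ_mul_one_add (f : R⟦X⟧) (c : R) (n : ℕ) :
    coeff (n + 1) (f * (1 + C c * X)) = coeff (n + 1) f + c * coeff n f := by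
  rw [mul_add, mul_one, map_add, mul_left_comm, coeff_C_mul, coeff_succ_mul_X]

/-- Dividing ∏ (1 + c_i u) by 1 + b u leaves a polynomial part of degree below `#S` and a geometric
tail; only the tail is seen here. The offset `m` is needed because the induction uses two
consecutive coefficients. -/
theorem coeff_geom_mul_prod (b : R) (c : ι → R) (S : Finset ι) (m : ℕ) :
    coeff (#S + m) (PowerSeries.mk (fun n => (-b) ^ n) * ∏ i ∈ S, (1 + C (c i) * X)) =
      (-b) ^ m * ∏ i ∈ S, (c i - b) := by
  induction S using Finset.induction_on generalizing m with
  | empty => simp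
  | insert j S hj ih =>
    rw [prod_insert hj, prod_insert hj, card_insert_of_notMem hj, mul_comm (1 + _), ← mul_assoc,
      add_right_comm, coeff_succ_mul_one_add, ih, add_assoc, ih]
    ring

theorem coeff_prod_eq_zero (c : ι → R) (S : Finset ι) (m : ℕ) :
    coeff (#S + 1 + m) (∏ i ∈ S, (1 + C (c i) * X)) = 0 := by
  induction S using Finset.induction_on generalizing m with
  | empty =>
    rw [prod_empty, coeff_one, if_neg (by omega)]
  | insert j S hj ih =>
    rw [prod_insert hj, card_insert_of_notMem hj, mul_comm (1 + _), add_right_comm,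
      coeff_succ_mul_one_add, ih, add_assoc, ih, mul_zero, add_zero]

theorem geom_mul_one_add (b : R) :
    PowerSeries.mk (fun n => (-b) ^ n) * (1 + C b * X) = 1 := by
  ext n
  cases n with
  | zero => simp
  | succ n =>
    rw [coeff_succ_mul_one_add, coeff_mk, coeff_mk, coeff_one, if_neg n.succ_ne_zero]
    ring

/-- Needed because the weight series is known to equal ∏ (1 + a_j u) only up to degree r. -/
theorem coeff_mul_congr {f g : R⟦X⟧} {n : ℕ} (h : ∀ k ≤ n, coeff k f = coeff k g) (l : R⟦X⟧) :
    coeff n (l * f) = coeff n (l * g) := by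
  rw [coeff_mul, coeff_mul]
  refine Finset.sum_congr rfl fun p hp => ?_
  rw [h _ (by have := mem_antidiagonal.1 hp; omega)]

end Coefficients

/-! ### Relations satisfied by the highest weight vector -/

namespace LoopTriple

/-- The power series `∏ (1 + a_j u)`. -/
def paramSeries {ι : Type*} [Fintype ι] (a : ι → ℂ) : ℂ⟦X⟧ := ∏ i, (1 + C (a i) * X)

/-- The polynomial `∏_{i ≠ j} (t - a_i)`. -/
def basisPoly {ι : Type*} [Fintype ι] [DecidableEq ι] (a : ι → ℂ) (j : ι) : Polynomial ℂ :=
  ∏ i ∈ univ.erase j, (Polynomial.X - Polynomial.C (a i))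

section

variable {ι : Type*} [Fintype ι] [DecidableEq ι] {a : ι → ℂ}

theorem eval_basisPoly_of_ne {i j : ι} (h : i ≠ j) : (basisPoly a j).eval (a i) = 0 := by
  rw [basisPoly, Polynomial.eval_prod]
  exact Finset.prod_eq_zero (mem_erase.2 ⟨h, mem_univ i⟩) (by simp)

theorem eval_basisPoly_self (ha : Function.Injective a) (j : ι) :
    (basisPoly a j).eval (a j) ≠ 0 := by
  rw [basisPoly, Polynomial.eval_prod]
  refine Finset.prod_ne_zero_iff.2 fun i hi => ?_
  simpa [sub_eq_zero] using fun h => ne_of_mem_erase hi (ha h).symm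

variable {A V : Type*} [Ring A] [Algebra ℂ A] [AddCommGroup V] [Module ℂ V] [Module A V]
  [IsScalarTower ℂ A V] {T : LoopTriple A} {δ : Polynomial ℂ →ₗ[ℂ] ℂ} {Ψ : V}

theorem coeff_Y_mul (l : ℂ⟦X⟧) (n : ℕ) : coeff n (T.Y * psMap A l) =
    T.F (coeff n (PowerSeries.mk (fun i => (-Polynomial.X) ^ i) *
      PowerSeries.map Polynomial.C l)) := by
  rw [coeff_mul, coeff_mul, map_sum]
  refine Finset.sum_congr rfl fun p _ => ?_
  rw [Y, coeff_mk, coeff_mk, coeff_map, coeff_map, mul_comm, ← Polynomial.smul_eq_C_mul, map_smul,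
    Algebra.smul_def, Algebra.commutes]

theorem coeff_smul_eq_zero (hΨ : T.IsHighest δ Ψ) {m k : ℕ} (h : T.F 1 ^ (m + k) • Ψ = 0) :
    coeff k (T.Y ^ m * psMap A (weightSeries δ)) • Ψ = 0 := by
  have h1 := e_pow_smul_F_one_pow hΨ m k
  rw [h, smul_zero, smul_zero, eq_comm] at h1
  refine (smul_eq_zero.1 h1).resolve_left ?_
  exact mul_ne_zero (Nat.cast_ne_zero.2 (Nat.factorial_ne_zero _))
    (Nat.cast_ne_zero.2 (Nat.factorial_ne_zero _))

/-- Y is `F` applied to 1 / (1 + t u), and the coefficient of ∏ (1 + a_i u) / (1 + t u) in degree r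
is ∏ (a_i - t). -/
theorem F_prod_smul (hΨ : T.IsHighest δ Ψ) (hnil : T.F 1 ^ (Fintype.card ι + 1) • Ψ = 0)
    (hw : ∀ k ≤ Fintype.card ι, coeff k (weightSeries δ) = coeff k (paramSeries a)) :
    T.F (∏ i, (Polynomial.C (a i) - Polynomial.X)) • Ψ = 0 := by
  have h := coeff_smul_eq_zero (m := 1) (k := Fintype.card ι) hΨ (by rwa [add_comm])
  have h2 := coeff_geom_mul_prod Polynomial.X (fun i => Polynomial.C (a i)) univ 0
  rw [pow_one, coeff_Y_mul, coeff_mul_congr (g := PowerSeries.map Polynomial.C (paramSeries a))]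
    at h
  · rw [pow_zero, one_mul, add_zero, card_univ] at h2
    rw [← h2]
    convert h using 5
    simp [paramSeries]
  · intro k hk
    rw [coeff_map, coeff_map, hw k hk]

/-- Distinctness makes `f` a multiple g p of p = ∏ (a_i - t). As `F p` kills Ψ and Ψ is an
eigenvector of `H g`, their commutator -2 `F (g p)` kills Ψ too. -/
theorem F_smul_eq_zero (hΨ : T.IsHighest δ Ψ) (ha : Function.Injective a)
    (hnil : T.F 1 ^ (Fintype.card ι + 1) • Ψ = 0)
    (hw : ∀ k ≤ Fintype.card ι, coeff k (weightSeries δ) = coeff k (paramSeries a))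
    (f : Polynomial ℂ) (hf : ∀ i, f.eval (a i) = 0) : T.F f • Ψ = 0 := by
  have h1 : ∏ i, (Polynomial.C (a i) - Polynomial.X) ∣ f := by
    refine Fintype.prod_dvd_of_coprime (fun i j hij => ?_) fun i => ?_
    · have := (Polynomial.pairwise_coprime_X_sub_C ha hij).neg_neg
      simpa [Function.onFun] using this
    · rw [← neg_dvd, neg_sub]
      exact Polynomial.dvd_iff_isRoot.2 (hf i)
  obtain ⟨g, rfl⟩ := h1
  have h2 := F_prod_smul hΨ hnil hw
  have h3 := congr_arg (fun x => x • Ψ) (T.H_F g (∏ i, (Polynomial.C (a i) - Polynomial.X)))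
  simp only [sub_smul, mul_smul, h2, hΨ.H_smul, smul_zero, smul_comm _ (δ g), zero_sub,
    smul_assoc] at h3
  rw [mul_comm]
  simpa using h3

/-- Lagrange interpolation at the points `a j`: the difference vanishes at all of them. -/
theorem F_smul_eq_sum (ha : Function.Injective a)
    (hF : ∀ f : Polynomial ℂ, (∀ i, f.eval (a i) = 0) → T.F f • Ψ = 0) (f : Polynomial ℂ) :
    T.F f • Ψ =
      ∑ j, (f.eval (a j) * ((basisPoly a j).eval (a j))⁻¹) • T.F (basisPoly a j) • Ψ := by
  have h := hF (f - ∑ j, (f.eval (a j) * ((basisPoly a j).eval (a j))⁻¹) • basisPoly a j) ?_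
  · rw [map_sub, map_sum, sub_smul, Finset.sum_smul, sub_eq_zero] at h
    simpa only [map_smul, smul_assoc] using h
  · intro i
    rw [Polynomial.eval_sub, Polynomial.eval_finsetSum, Finset.sum_eq_single i]
    · rw [Polynomial.eval_smul, smul_eq_mul, inv_mul_cancel_right₀ (eval_basisPoly_self ha i),
        sub_self]
    · intro j _ hj
      rw [Polynomial.eval_smul, eval_basisPoly_of_ne hj.symm, smul_zero]
    · simp

theorem F_mul_basisPoly_smul
    (hF : ∀ f : Polynomial ℂ, (∀ i, f.eval (a i) = 0) → T.F f • Ψ = 0) (f : Polynomial ℂ)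
    (j : ι) : T.F (f * basisPoly a j) • Ψ = f.eval (a j) • T.F (basisPoly a j) • Ψ := by
  have h := hF (f * basisPoly a j - f.eval (a j) • basisPoly a j) fun i => by
    rw [Polynomial.eval_sub, Polynomial.eval_smul, Polynomial.eval_mul, smul_eq_mul, ← sub_mul]
    rcases eq_or_ne i j with rfl | h
    · rw [sub_self, zero_mul]
    · rw [eval_basisPoly_of_ne h, mul_zero]
  rwa [map_sub, map_smul, sub_smul, smul_assoc, sub_eq_zero] at h

/-- The power series `∑_j x⁻(t f_j) / (f_j(a_j) (1 + a_j u))`, which acts on `Ψ` as `Y`. -/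
def Z (T : LoopTriple A) (a : ι → ℂ) : A⟦X⟧ :=
  ∑ j, C (T.F (basisPoly a j)) *
    psMap A (C ((basisPoly a j).eval (a j))⁻¹ * PowerSeries.mk fun n => (-a j) ^ n)

theorem agreeOn_Y_Z (ha : Function.Injective a)
    (hF : ∀ f : Polynomial ℂ, (∀ i, f.eval (a i) = 0) → T.F f • Ψ = 0) :
    AgreeOn Ψ T.Y (T.Z a) := by
  intro n
  rw [Y, Z, coeff_mk, F_smul_eq_sum ha hF, map_sum, Finset.sum_smul]
  refine Finset.sum_congr rfl fun j _ => ?_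
  rw [coeff_C_mul, coeff_map, coeff_C_mul, coeff_mk, ← Algebra.commutes, ← Algebra.smul_def,
    smul_assoc]
  simp [mul_comm]

theorem commute_Y_Z : Commute T.Y (T.Z a) := by
  refine commute_of_coeff fun i j => ?_
  rw [Y, Z, coeff_mk, map_sum]
  refine Commute.sum_right _ _ _ fun k _ => ?_
  rw [coeff_C_mul, coeff_map]
  exact (T.F_comm _ _).mul_right (Algebra.commutes _ _).symm

theorem psMap_mul_Z_sq (l : ℂ⟦X⟧) : psMap A l * (T.Z a * T.Z a) =
    ∑ i, ∑ j, C (T.F (basisPoly a i) * T.F (basisPoly a j)) *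
      psMap A (C (((basisPoly a i).eval (a i))⁻¹ * ((basisPoly a j).eval (a j))⁻¹) *
        ((PowerSeries.mk fun n => (-a i) ^ n) * (PowerSeries.mk fun n => (-a j) ^ n) * l)) := by
  rw [Z, Finset.sum_mul_sum, Finset.mul_sum]
  refine Finset.sum_congr rfl fun i _ => ?_
  rw [Finset.mul_sum]
  refine Finset.sum_congr rfl fun j _ => ?_
  rw [(commute_psMap l _).eq, (commute_psMap _ (C (T.F (basisPoly a j)))).mul_mul_mul_comm,
    mul_assoc (_ * _), ← map_mul (psMap A), ← map_mul (psMap A), ← map_mul (C (R := A)),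
    map_mul (C (R := ℂ))]
  congr 2
  ring

/-- On Ψ, Y² l becomes a double sum over i, j with scalar factor l / ((1 + a_i u)(1 + a_j u)). In
degree r - 1 the cross terms vanish, being polynomials of degree at most r - 2; the diagonal ones
leave ∏_{i ≠ j} (a_i - a_j) ≠ 0. -/
theorem sum_smul_F_sq (hΨ : T.IsHighest δ Ψ) (ha : Function.Injective a)
    (hF : ∀ f : Polynomial ℂ, (∀ i, f.eval (a i) = 0) → T.F f • Ψ = 0)
    (hnil : T.F 1 ^ (Fintype.card ι + 1) • Ψ = 0)
    (hw : ∀ k ≤ Fintype.card ι, coeff k (weightSeries δ) = coeff k (paramSeries a)) :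
    ∃ β : ι → ℂ, (∀ j, β j ≠ 0) ∧
      ∑ j, β j • T.F (basisPoly a j) • T.F (basisPoly a j) • Ψ = 0 := by
  rcases isEmpty_or_nonempty ι with hι | hι
  · exact ⟨fun _ => 1, fun _ => one_ne_zero, by simp⟩
  obtain ⟨k, hk⟩ : ∃ k, Fintype.card ι = k + 1 := Nat.exists_eq_succ_of_ne_zero Fintype.card_ne_zero
  have hcard : ∀ j : ι, #(univ.erase j) = k := fun j => by
    rw [card_erase_of_mem (mem_univ j), card_univ, hk, Nat.add_sub_cancel]
  have hself : ∀ j, coeff k ((PowerSeries.mk fun n => (-a j) ^ n) *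
      (PowerSeries.mk fun n => (-a j) ^ n) * paramSeries a) =
      ∏ i ∈ univ.erase j, (a i - a j) := fun j => by
    have h := coeff_geom_mul_prod (a j) a (univ.erase j) 0
    rw [hcard, pow_zero, one_mul, add_zero] at h
    rw [← h, paramSeries, ← mul_prod_erase univ _ (mem_univ j), mul_assoc, ← mul_assoc _ (1 + _),
      geom_mul_one_add, one_mul]
  have hne : ∀ i j, i ≠ j → coeff k ((PowerSeries.mk fun n => (-a i) ^ n) *
      (PowerSeries.mk fun n => (-a j) ^ n) * paramSeries a) = 0 := fun i j hij => by
    have hi : i ∈ univ.erase j := mem_erase.2 ⟨hij, mem_univ i⟩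
    have hc : k = #((univ.erase j).erase i) + 1 + 0 := by
      rw [card_erase_of_mem hi, hcard]
      have := Finset.card_pos.2 ⟨i, hi⟩
      rw [hcard] at this
      omega
    rw [paramSeries, ← mul_prod_erase univ _ (mem_univ j), mul_assoc, ← mul_assoc _ (1 + _),
      geom_mul_one_add, one_mul, ← mul_prod_erase _ _ hi, ← mul_assoc, geom_mul_one_add, one_mul]
    conv_lhs => rw [hc]
    exact coeff_prod_eq_zero _ _ _
  refine ⟨fun j => ((basisPoly a j).eval (a j))⁻¹ * ((basisPoly a j).eval (a j))⁻¹ *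
    ∏ i ∈ univ.erase j, (a i - a j), fun j => ?_, ?_⟩
  · have h1 := inv_ne_zero (eval_basisPoly_self ha j)
    refine mul_ne_zero (mul_ne_zero h1 h1) (Finset.prod_ne_zero_iff.2 fun i hi => ?_)
    exact sub_ne_zero.2 fun h => ne_of_mem_erase hi (ha h)
  · have h1 := coeff_smul_eq_zero (m := 2) (k := k) hΨ (by rwa [hk, add_assoc, add_comm] at hnil)
    -- Agreement on Ψ survives only left multiplication: the right factor Y is replaced by Z, the
    -- factors are swapped, and then the other Y is replaced.
    have h2 := agreeOn_Y_Z ha hF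
    rw [← (commute_psMap _ _).eq, sq, h2.mul_left T.Y |>.mul_left _ k, commute_Y_Z.eq,
      h2.mul_left (T.Z a) |>.mul_left _ k, psMap_mul_Z_sq, map_sum, Finset.sum_smul] at h1
    rw [← h1]
    refine Finset.sum_congr rfl fun i _ => ?_
    have h3 : ∀ j, coeff k ((PowerSeries.mk fun n => (-a i) ^ n) *
      (PowerSeries.mk fun n => (-a j) ^ n) * weightSeries δ) = coeff k ((PowerSeries.mk fun n =>
        (-a i) ^ n) * (PowerSeries.mk fun n => (-a j) ^ n) * paramSeries a) := fun j =>
      coeff_mul_congr (fun l hl => hw l (by omega)) _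
    rw [map_sum, Finset.sum_smul, Finset.sum_eq_single i]
    · rw [coeff_C_mul, coeff_map, coeff_C_mul, h3, hself, ← Algebra.commutes,
        ← Algebra.smul_def, smul_assoc, mul_smul (T.F _)]
    · intro j _ hj
      rw [coeff_C_mul, coeff_map, coeff_C_mul, h3, hne i j hj.symm, mul_zero, map_zero, mul_zero,
        zero_smul]
    · simp

/-- `H g` has eigenvalue δ(g) - 4 g(a_i) on the i-th square. Applied to the vanishing sum, the δ(g)
part drops out, and g = f_j kills every term but the j-th. -/
theorem F_sq_smul (hΨ : T.IsHighest δ Ψ) (ha : Function.Injective a)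
    (hF : ∀ f : Polynomial ℂ, (∀ i, f.eval (a i) = 0) → T.F f • Ψ = 0)
    (hnil : T.F 1 ^ (Fintype.card ι + 1) • Ψ = 0)
    (hw : ∀ k ≤ Fintype.card ι, coeff k (weightSeries δ) = coeff k (paramSeries a)) (j : ι) :
    T.F (basisPoly a j) • T.F (basisPoly a j) • Ψ = 0 := by
  obtain ⟨β, hβ, hsum⟩ := sum_smul_F_sq hΨ ha hF hnil hw
  have hH : ∀ g i, T.H g • T.F (basisPoly a i) • T.F (basisPoly a i) • Ψ =
      (δ g - 4 * g.eval (a i)) • T.F (basisPoly a i) • T.F (basisPoly a i) • Ψ := fun g i => by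
    have h1 := F_mul_basisPoly_smul hF g i
    have h2 : ∀ v : V, T.H g • T.F (basisPoly a i) • v = T.F (basisPoly a i) • T.H g • v -
        (2 : ℂ) • T.F (g * basisPoly a i) • v := fun v => by
      rw [← mul_smul, T.H_F, sub_smul, mul_smul, smul_assoc]
    rw [h2, h2, hΨ.H_smul, ← mul_smul (T.F (g * _)), (T.F_comm _ _).eq, mul_smul, h1, smul_sub,
      smul_comm _ (δ g), smul_comm _ (δ g), smul_comm _ (2 : ℂ), smul_comm _ (g.eval _)]
    generalize T.F (basisPoly a i) • T.F (basisPoly a i) • Ψ = x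
    module
  have h1 := congr_arg (fun v => T.H (basisPoly a j) • v) hsum
  simp only [Finset.smul_sum, smul_comm (T.H _) (β _), hH, sub_smul, smul_sub,
    Finset.sum_sub_distrib, smul_zero] at h1
  simp only [smul_comm _ (δ _), ← Finset.smul_sum, hsum, smul_zero, zero_sub, neg_eq_zero] at h1
  rw [Finset.sum_eq_single j] at h1
  · have h2 := eval_basisPoly_self ha j
    simpa [hβ j, h2] using h1
  · intro i _ hi
    rw [eval_basisPoly_of_ne hi, mul_zero, zero_smul, smul_zero]
  · simp

end

end LoopTriple

end BorelLoop

/-! ### Products over subsets: span, independence, weights -/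

namespace BorelLoop

open Finset

namespace LoopTriple

section

variable {ι : Type*} [Fintype ι] [DecidableEq ι] {A V : Type*} [Ring A] [Algebra ℂ A]
  [AddCommGroup V] [Module A V]

/-- The product `∏_{j ∈ S} x⁻(t f_j)`. -/
def rhoProd (T : LoopTriple A) (a : ι → ℂ) (S : Finset ι) : A :=
  S.noncommProd (fun j => T.F (basisPoly a j)) fun _ _ _ _ _ => T.F_comm _ _

variable {T : LoopTriple A} {a : ι → ℂ} {Ψ : V}

theorem rhoProd_empty : T.rhoProd a ∅ = 1 := noncommProd_empty _ _

theorem rhoProd_insert {j : ι} {S : Finset ι} (hj : j ∉ S) :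
    T.rhoProd a (insert j S) = T.F (basisPoly a j) * T.rhoProd a S :=
  noncommProd_insert_of_notMem _ _ _ _ hj

theorem commute_F_rhoProd (f : Polynomial ℂ) (S : Finset ι) : Commute (T.F f) (T.rhoProd a S) :=
  noncommProd_commute _ _ _ _ fun _ _ => T.F_comm _ _

theorem F_smul_rhoProd_comm (f : Polynomial ℂ) (S : Finset ι) (v : V) :
    T.F f • T.rhoProd a S • v = T.rhoProd a S • T.F f • v := by
  rw [← mul_smul, (commute_F_rhoProd f S).eq, mul_smul]

theorem F_smul_rhoProd_of_mem (hsq : ∀ j, T.F (basisPoly a j) • T.F (basisPoly a j) • Ψ = 0)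
    {j : ι} {S : Finset ι} (hj : j ∈ S) :
    T.F (basisPoly a j) • T.rhoProd a S • Ψ = 0 := by
  rw [← insert_erase hj, rhoProd_insert (notMem_erase j S), mul_smul, F_smul_rhoProd_comm,
    F_smul_rhoProd_comm, hsq, smul_zero]

theorem rhoProd_smul_of_disjoint {S S' : Finset ι} (h : Disjoint S S') :
    T.rhoProd a S • T.rhoProd a S' • Ψ = T.rhoProd a (S ∪ S') • Ψ := by
  rw [← mul_smul]
  exact congr_arg (· • Ψ) (noncommProd_union_of_disjoint h _ _).symm

theorem rhoProd_smul_of_not_disjoint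
    (hsq : ∀ j, T.F (basisPoly a j) • T.F (basisPoly a j) • Ψ = 0) {S S' : Finset ι}
    (h : ¬ Disjoint S S') : T.rhoProd a S • T.rhoProd a S' • Ψ = 0 := by
  obtain ⟨j, hj, hj'⟩ := not_disjoint_iff.1 h
  rw [← insert_erase hj, rhoProd_insert (notMem_erase j S), mul_smul, F_smul_rhoProd_comm,
    F_smul_rhoProd_of_mem hsq hj', smul_zero]

variable [Module ℂ V] [IsScalarTower ℂ A V] {δ : Polynomial ℂ →ₗ[ℂ] ℂ}

theorem H_smul_rhoProd (hΨ : T.IsHighest δ Ψ)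
    (hF : ∀ f : Polynomial ℂ, (∀ i, f.eval (a i) = 0) → T.F f • Ψ = 0) (g : Polynomial ℂ)
    (S : Finset ι) : T.H g • T.rhoProd a S • Ψ =
      (δ g - 2 * ∑ j ∈ S, g.eval (a j)) • T.rhoProd a S • Ψ := by
  induction S using Finset.induction_on with
  | empty => simp [rhoProd_empty, hΨ.H_smul]
  | insert j S hj ih =>
    rw [rhoProd_insert hj, mul_smul, ← mul_smul (T.H g), T.H_F, sub_smul, mul_smul, ih, smul_assoc,
      F_smul_rhoProd_comm (g * _), F_mul_basisPoly_smul hF, sum_insert hj, F_smul_rhoProd_comm,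
      smul_comm (T.F _) (_ - _ : ℂ), F_smul_rhoProd_comm, smul_comm (T.rhoProd a S) (g.eval _)]
    generalize T.rhoProd a S • T.F (basisPoly a j) • Ψ = x
    module

/-- All `F` commute, so `F f` can be moved onto Ψ and interpolated; indices already in `S` give
squares, hence zero, and the others enlarge `S` by one. -/
theorem F_smul_rhoProd_mem (ha : Function.Injective a)
    (hF : ∀ f : Polynomial ℂ, (∀ i, f.eval (a i) = 0) → T.F f • Ψ = 0)
    (hsq : ∀ j, T.F (basisPoly a j) • T.F (basisPoly a j) • Ψ = 0)
    (f : Polynomial ℂ) (S : Finset ι) : T.F f • T.rhoProd a S • Ψ ∈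
      Submodule.span ℂ ((fun S' => T.rhoProd a S' • Ψ) '' {S' | #S' = #S + 1}) := by
  rw [F_smul_rhoProd_comm, F_smul_eq_sum ha hF, smul_sum]
  refine Submodule.sum_mem _ fun j _ => ?_
  rw [smul_comm, ← F_smul_rhoProd_comm]
  refine Submodule.smul_mem _ _ ?_
  by_cases hj : j ∈ S
  · rw [F_smul_rhoProd_of_mem hsq hj]
    exact zero_mem _
  · rw [← mul_smul, ← rhoProd_insert hj]
    exact Submodule.subset_span ⟨_, card_insert_of_notMem hj, rfl⟩

theorem F_one_pow_smul_mem (ha : Function.Injective a)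
    (hF : ∀ f : Polynomial ℂ, (∀ i, f.eval (a i) = 0) → T.F f • Ψ = 0)
    (hsq : ∀ j, T.F (basisPoly a j) • T.F (basisPoly a j) • Ψ = 0) (k : ℕ) :
    T.F 1 ^ k • Ψ ∈ Submodule.span ℂ ((fun S => T.rhoProd a S • Ψ) '' {S | #S = k}) := by
  induction k with
  | zero =>
    rw [pow_zero]
    exact Submodule.subset_span ⟨∅, rfl, congr_arg (· • Ψ) rhoProd_empty⟩
  | succ k ih =>
    rw [pow_succ', mul_smul]
    generalize T.F 1 ^ k • Ψ = v at ih
    induction ih using Submodule.span_induction with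
    | mem x hx =>
      obtain ⟨S, rfl, rfl⟩ := hx
      exact F_smul_rhoProd_mem ha hF hsq 1 S
    | zero => simp
    | add x y _ _ hx hy =>
      rw [smul_add]
      exact add_mem hx hy
    | smul c x _ hx =>
      rw [smul_comm]
      exact Submodule.smul_mem _ c hx

/-- The only subset of full cardinality is `univ`, so the nonzero top power of `F 1` on Ψ is a
multiple of this vector. -/
theorem rhoProd_univ_smul_ne_zero (ha : Function.Injective a)
    (hF : ∀ f : Polynomial ℂ, (∀ i, f.eval (a i) = 0) → T.F f • Ψ = 0)
    (hsq : ∀ j, T.F (basisPoly a j) • T.F (basisPoly a j) • Ψ = 0)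
    (hne : T.F 1 ^ Fintype.card ι • Ψ ≠ 0) : T.rhoProd a univ • Ψ ≠ 0 := by
  intro h0
  refine hne ?_
  rw [← Submodule.mem_bot ℂ]
  refine Submodule.span_le.2 ?_ (F_one_pow_smul_mem ha hF hsq _)
  rintro _ ⟨S, hS, rfl⟩
  rw [(card_eq_iff_eq_univ S).1 hS]
  exact h0

theorem linearIndependent_rhoProd (ha : Function.Injective a)
    (hF : ∀ f : Polynomial ℂ, (∀ i, f.eval (a i) = 0) → T.F f • Ψ = 0)
    (hsq : ∀ j, T.F (basisPoly a j) • T.F (basisPoly a j) • Ψ = 0)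
    (hne : T.F 1 ^ Fintype.card ι • Ψ ≠ 0) :
    LinearIndependent ℂ fun S => T.rhoProd a S • Ψ := by
  rw [Fintype.linearIndependent_iff]
  intro c hc S
  induction S using Finset.strongInduction with
  | H S ih =>
    -- Multiplying by the complementary product kills every S' not contained in S, through a
    -- repeated index; proper subsets already have coefficient zero, and S itself yields the full
    -- product.
    have h := congr_arg (fun v => T.rhoProd a Sᶜ • v) hc
    simp only [smul_sum, smul_zero] at h
    rw [Finset.sum_eq_single S] at h
    · rw [smul_comm, rhoProd_smul_of_disjoint disjoint_compl_left, union_comm, union_compl] at h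
      exact (smul_eq_zero.1 h).resolve_right (rhoProd_univ_smul_ne_zero ha hF hsq hne)
    · intro S' _ hS'
      by_cases hsub : S' ⊆ S
      · rw [ih S' (hsub.ssubset_of_ne hS'), zero_smul, smul_zero]
      · rw [smul_comm, rhoProd_smul_of_not_disjoint hsq, smul_zero]
        rwa [disjoint_compl_left_iff]
    · simp

theorem H_smul_mem_span (hΨ : T.IsHighest δ Ψ)
    (hF : ∀ f : Polynomial ℂ, (∀ i, f.eval (a i) = 0) → T.F f • Ψ = 0) (g : Polynomial ℂ)
    (S : Finset ι) : T.H g • T.rhoProd a S • Ψ ∈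
      Submodule.span ℂ (Set.range fun S' => T.rhoProd a S' • Ψ) := by
  rw [H_smul_rhoProd hΨ hF]
  exact Submodule.smul_mem _ _ (Submodule.subset_span ⟨S, rfl⟩)

theorem F_smul_mem_span (ha : Function.Injective a)
    (hF : ∀ f : Polynomial ℂ, (∀ i, f.eval (a i) = 0) → T.F f • Ψ = 0)
    (hsq : ∀ j, T.F (basisPoly a j) • T.F (basisPoly a j) • Ψ = 0)
    (f : Polynomial ℂ) (S : Finset ι) : T.F f • T.rhoProd a S • Ψ ∈
      Submodule.span ℂ (Set.range fun S' => T.rhoProd a S' • Ψ) :=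
  Submodule.span_mono (Set.image_subset_range _ _) (F_smul_rhoProd_mem ha hF hsq f S)

theorem smul_mem_span_of_forall {x : A}
    (h : ∀ S, x • T.rhoProd a S • Ψ ∈ Submodule.span ℂ (Set.range fun S' => T.rhoProd a S' • Ψ))
    {v : V} (hv : v ∈ Submodule.span ℂ (Set.range fun S' => T.rhoProd a S' • Ψ)) :
    x • v ∈ Submodule.span ℂ (Set.range fun S' => T.rhoProd a S' • Ψ) := by
  induction hv using Submodule.span_induction with
  | mem y hy =>
    obtain ⟨S, rfl⟩ := hy
    exact h S
  | zero => simp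
  | add y z _ _ hy hz =>
    rw [smul_add]
    exact add_mem hy hz
  | smul c y _ hy =>
    rw [smul_comm]
    exact Submodule.smul_mem _ c hy

theorem e_smul_mem_span (hΨ : T.IsHighest δ Ψ) (ha : Function.Injective a)
    (hF : ∀ f : Polynomial ℂ, (∀ i, f.eval (a i) = 0) → T.F f • Ψ = 0)
    (hsq : ∀ j, T.F (basisPoly a j) • T.F (basisPoly a j) • Ψ = 0)
    (S : Finset ι) : T.e • T.rhoProd a S • Ψ ∈
      Submodule.span ℂ (Set.range fun S' => T.rhoProd a S' • Ψ) := by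
  induction S using Finset.induction_on with
  | empty =>
    rw [rhoProd_empty, one_smul, hΨ.e_smul]
    exact zero_mem _
  | insert j S hj ih =>
    rw [rhoProd_insert hj, mul_smul, ← mul_smul T.e, T.e_F, add_smul, mul_smul]
    exact add_mem (smul_mem_span_of_forall (F_smul_mem_span ha hF hsq _) ih)
      (H_smul_mem_span hΨ hF _ S)

/-- The product over `S` has `H 1`-eigenvalue δ(1) - 2 `#S`; by independence only subsets with `#S =
n` can occur. -/
theorem mem_span_of_weight (hΨ : T.IsHighest δ Ψ) (ha : Function.Injective a)
    (hF : ∀ f : Polynomial ℂ, (∀ i, f.eval (a i) = 0) → T.F f • Ψ = 0)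
    (hsq : ∀ j, T.F (basisPoly a j) • T.F (basisPoly a j) • Ψ = 0)
    (hne : T.F 1 ^ Fintype.card ι • Ψ ≠ 0) {v : V} {n : ℕ}
    (hv : v ∈ Submodule.span ℂ (Set.range fun S => T.rhoProd a S • Ψ))
    (hn : T.H 1 • v = (δ 1 - 2 * (n : ℂ)) • v) :
    v ∈ Submodule.span ℂ ((fun S => T.rhoProd a S • Ψ) '' {S | #S = n}) := by
  obtain ⟨c, rfl⟩ := (Submodule.mem_span_range_iff_exists_fun ℂ).1 hv
  have h1 : ∑ S, (2 * ((n : ℂ) - #S) * c S) • T.rhoProd a S • Ψ = 0 := by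
    rw [← sub_eq_zero, smul_sum, smul_sum, ← Finset.sum_sub_distrib] at hn
    rw [← hn]
    refine Finset.sum_congr rfl fun S _ => ?_
    rw [smul_comm (T.H 1), H_smul_rhoProd hΨ hF]
    simp only [Polynomial.eval_one, sum_const, nsmul_eq_mul, mul_one]
    generalize T.rhoProd a S • Ψ = x
    module
  have h2 := Fintype.linearIndependent_iff.1 (linearIndependent_rhoProd ha hF hsq hne) _ h1
  refine Submodule.sum_mem _ fun S _ => ?_
  by_cases hS : #S = n
  · exact Submodule.smul_mem _ _ (Submodule.subset_span ⟨S, hS, rfl⟩)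
  · have h3 : c S = 0 := by
      refine (mul_eq_zero.1 (h2 S)).resolve_left ?_
      refine mul_ne_zero two_ne_zero (sub_ne_zero.2 fun h => hS ?_)
      exact_mod_cast h.symm
    rw [h3, zero_smul]
    exact zero_mem _

end

end LoopTriple

end BorelLoop

/-! ### Realisation inside U(B) -/

namespace BorelLoop

open Finset LoopTriple

open Polynomial (C X monomial)

/-- The linear map on polynomials that sends `tᵏ` to `v k`. -/
def polyLift {M : Type*} [AddCommGroup M] [Module ℂ M] (v : ℕ → M) : Polynomial ℂ →ₗ[ℂ] M :=
  (Polynomial.basisMonomials ℂ).constr ℂ v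

theorem polyLift_monomial {M : Type*} [AddCommGroup M] [Module ℂ M] (v : ℕ → M) (n : ℕ) (c : ℂ) :
    polyLift v (monomial n c) = c • v n := by
  have h := (Polynomial.basisMonomials ℂ).constr_basis ℂ v n
  rw [Polynomial.coe_basisMonomials] at h
  rw [← mul_one c, ← smul_eq_mul, ← Polynomial.smul_monomial, map_smul, polyLift, h, smul_eq_mul,
    mul_one]

/-- The triple determined by sequences `x_{k+1}⁻` and `h_k`. -/
def LoopTriple.ofSeq {A : Type*} [Ring A] [Algebra ℂ A] (e : A) (x h : ℕ → A)
    (hx : ∀ j k, x j * x k = x k * x j) (he : ∀ k, e * x k = x k * e + h (1 + k))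
    (hh : ∀ j k, h j * x k = x k * h j - (2 : ℂ) • x (j + k)) : LoopTriple A where
  e := e
  F := polyLift x
  H := polyLift h
  F_comm f g := by
    induction f using Polynomial.induction_on' with
    | add p q hp hq =>
      rw [map_add]
      exact hp.add_left hq
    | monomial n c =>
      induction g using Polynomial.induction_on' with
      | add p q hp hq =>
        rw [map_add]
        exact hp.add_right hq
      | monomial m b =>
        rw [polyLift_monomial, polyLift_monomial]
        exact ((show Commute _ _ from hx n m).smul_left c).smul_right b
  e_F f := by
    induction f using Polynomial.induction_on' with
    | add p q hp hq =>
      rw [map_add, mul_add, hp, hq, mul_add, map_add, add_mul]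
      abel
    | monomial n c =>
      rw [Polynomial.X_mul_monomial, polyLift_monomial, polyLift_monomial, mul_smul_comm,
        he, smul_add, smul_mul_assoc, add_comm 1]
  H_F f g := by
    induction f using Polynomial.induction_on' with
    | add p q hp hq =>
      rw [map_add, add_mul, hp, hq, mul_add, add_mul, map_add, smul_add]
      abel
    | monomial n c =>
      induction g using Polynomial.induction_on' with
      | add p q hp hq =>
        rw [map_add, mul_add, hp, hq, mul_add, map_add, add_mul, smul_add]
        abel
      | monomial m b =>
        rw [Polynomial.monomial_mul_monomial, polyLift_monomial, polyLift_monomial,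
          polyLift_monomial, smul_mul_smul_comm, smul_mul_smul_comm, hh, smul_sub,
          mul_comm b, smul_comm (2 : ℂ)]

/-- `x_{k+1}⁻` (`k ≥ 0`) as an element of `U(B)`. -/
def bxMinusSucc (k : ℕ) : UB := ⟨xMinus (k + 1 : ℕ), xMinus_mem _ k.succ_pos⟩

theorem bxMinusSucc_comm (j k : ℕ) : bxMinusSucc j * bxMinusSucc k = bxMinusSucc k * bxMinusSucc j :=
  Subtype.ext (sub_eq_zero.1 (xMinus_comm _ _))

theorem bxPlus_bxMinusSucc (k : ℕ) :
    bxPlus 0 * bxMinusSucc k = bxMinusSucc k * bxPlus 0 + bh (1 + k) := by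
  refine Subtype.ext ?_
  have h := xPlus_xMinus_comm 0 ((k + 1 : ℕ) : ℤ)
  rw [sub_eq_iff_eq_add', zero_add] at h
  rw [add_comm 1]
  exact h

theorem bh_bxMinusSucc (j k : ℕ) :
    bh j * bxMinusSucc k = bxMinusSucc k * bh j - (2 : ℂ) • bxMinusSucc (j + k) := by
  refine Subtype.ext ?_
  have h := hGen_xMinus_comm j ((k + 1 : ℕ) : ℤ)
  rw [sub_eq_iff_eq_add', neg_smul, ← sub_eq_add_neg, ← Nat.cast_add, ← add_assoc] at h
  exact h

/-- The generators of `U(B)`. -/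
def borelTriple : LoopTriple UB :=
  LoopTriple.ofSeq (bxPlus 0) bxMinusSucc bh bxMinusSucc_comm bxPlus_bxMinusSucc bh_bxMinusSucc

theorem borelTriple_F_one : borelTriple.F 1 = bxMinusOne := by
  rw [← Polynomial.monomial_zero_one]
  exact (polyLift_monomial _ _ _).trans (one_smul _ _)

theorem borelTriple_H_one : borelTriple.H 1 = bh 0 := by
  rw [← Polynomial.monomial_zero_one]
  exact (polyLift_monomial _ _ _).trans (one_smul _ _)

theorem coe_borelTriple_F (f : Polynomial ℂ) :
    (borelTriple.F f : ULoop) = polyLift (fun k => xMinus k) (X * f) := by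
  induction f using Polynomial.induction_on' with
  | add p q hp hq => rw [map_add, mul_add, map_add, ← hp, ← hq, UB.coe_add]
  | monomial n c =>
    rw [Polynomial.X_mul_monomial, polyLift_monomial]
    exact congr_arg Subtype.val (polyLift_monomial bxMinusSucc n c)

/-- Vieta: the signed elementary symmetric functions are the coefficients of ∏ (t - α), α ∈ A. -/
theorem xMinusParam_eq (A : Multiset ℂ) :
    xMinusParam A = polyLift (fun k => xMinus k) (A.map fun t => X - C t).prod := by
  rw [Multiset.prod_X_sub_X_eq_sum_esymm, map_sum, xMinusParam]
  refine Finset.sum_congr rfl fun k hk => ?_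
  have hk' : k ≤ Multiset.card A := by
    have := Finset.mem_range.1 hk
    omega
  have h : (-1) ^ k * (C (A.esymm k) * X ^ (Multiset.card A - k)) =
      monomial (Multiset.card A - k) ((-1) ^ k * A.esymm k) := by
    rw [← Polynomial.C_mul_X_pow_eq_monomial]
    simp [mul_assoc]
  rw [h, polyLift_monomial, Nat.cast_sub hk']

/-- The parameter 0 in A_j⁽¹⁾ contributes exactly the factor t built into `F`. -/
theorem rhoMinus_eq {s : ℕ} (a : Fin s → ℂ) (j : Fin s) :
    rhoMinus a j = borelTriple.F (basisPoly a j) := by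
  refine Subtype.ext ?_
  refine (xMinusParam_eq _).trans ?_
  rw [coe_borelTriple_F, paramsWithout, Multiset.map_cons, Multiset.prod_cons, map_zero, sub_zero,
    Multiset.map_map]
  rfl

theorem prod_ofFn_rhoMinus {s n : ℕ} (a : Fin s → ℂ) (j : Fin n ↪o Fin s) :
    (List.ofFn fun t => rhoMinus a (j t)).prod =
      borelTriple.rhoProd a (univ.map j.toEmbedding) := by
  have h1 : univ.map j.toEmbedding = (List.ofFn j).toFinset := by
    ext i
    simp [List.mem_ofFn]
  have h2 : (List.ofFn fun t => rhoMinus a (j t)) =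
      (List.ofFn j).map fun i => borelTriple.F (basisPoly a i) := by
    rw [List.map_ofFn]
    exact congr_arg _ (funext fun t => rhoMinus_eq a (j t))
  rw [h1, h2]
  exact (noncommProd_toFinset _ _ _ (List.nodup_ofFn.2 j.injective)).symm

section

variable {V : Type*} [AddCommGroup V] [Module ℂ V] [Module UB V] [IsScalarTower ℂ UB V] {Ψ : V}
  {d : ℕ → ℂ}

theorem IsHighestWeightVector.isHighest (hΨ : IsHighestWeightVector d Ψ) :
    borelTriple.IsHighest (polyLift d) Ψ where
  e_smul := hΨ.xPlus_smul 0
  H_smul f := by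
    induction f using Polynomial.induction_on' with
    | add p q hp hq => rw [map_add, add_smul, hp, hq, map_add, add_smul]
    | monomial n c =>
      rw [polyLift_monomial, smul_assoc, ← hΨ.h_smul, ← smul_assoc]
      exact congr_arg (· • Ψ) (polyLift_monomial bh n c)

/-- The case `m = 0` of `e_pow_smul_F_one_pow`; since Ψ ≠ 0 the eigenvalue is unique, so the chosen
one is this coefficient. -/
theorem eigenvalue_eq (hΨ : IsHighestWeightVector d Ψ) (k : ℕ) :
    eigenvalue Ψ k = PowerSeries.coeff k (weightSeries (polyLift d)) := by
  have h1 := e_pow_smul_F_one_pow hΨ.isHighest 0 k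
  have h2 : (dividedPow (bxPlus 0) k * dividedPow bxMinusOne k) • Ψ =
      PowerSeries.coeff k (weightSeries (polyLift d)) • Ψ := by
    have hk : (k.factorial : ℂ) ≠ 0 := Nat.cast_ne_zero.2 k.factorial_ne_zero
    rw [pow_zero, one_mul, PowerSeries.coeff_map, algebraMap_smul, Nat.factorial_zero,
      Nat.cast_one, one_smul, zero_add, borelTriple_F_one] at h1
    rw [dividedPow, dividedPow, smul_mul_smul_comm, smul_assoc,
      mul_smul (bxPlus 0 ^ k), ← mul_inv, inv_smul_eq_iff₀ (mul_ne_zero hk hk)]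
    exact h1
  have h : ∃ c : ℂ, (dividedPow (bxPlus 0) k * dividedPow bxMinusOne k) • Ψ = c • Ψ := ⟨_, h2⟩
  rw [eigenvalue, dif_pos h]
  exact smul_left_injective ℂ hΨ.ne_zero (h.choose_spec.symm.trans h2)

theorem coeff_weightSeries_eq (hΨ : IsHighestWeightVector d Ψ) {s : ℕ} {a : Fin s → ℂ}
    (h : drinfeldPoly Ψ s = ∏ k, (1 - C (a k) * X)) {k : ℕ} (hk : k ≤ s) :
    PowerSeries.coeff k (weightSeries (polyLift d)) = PowerSeries.coeff k (paramSeries a) := by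
  -- P_Ψ is written in -u, the weight series in u.
  have h1 := congr_arg (fun p => p.comp (-X)) h
  simp only [drinfeldPoly, Polynomial.sum_comp, Polynomial.prod_comp, Polynomial.mul_comp,
    Polynomial.pow_comp, Polynomial.neg_comp, Polynomial.X_comp, Polynomial.C_comp, neg_neg,
    Polynomial.sub_comp, Polynomial.one_comp, mul_neg, sub_neg_eq_add] at h1
  have h2 : ((∏ i, (1 + C (a i) * X) : Polynomial ℂ) : PowerSeries ℂ) = paramSeries a := by
    rw [paramSeries, ← Polynomial.coeToPowerSeries.ringHom_apply, map_prod]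
    simp
  rw [← h2, Polynomial.coeff_coe, ← h1, Polynomial.finsetSum_coeff, Finset.sum_eq_single k]
  · rw [Polynomial.coeff_C_mul_X_pow, if_pos rfl, eigenvalue_eq hΨ]
  · intro i _ hi
    rw [Polynomial.coeff_C_mul_X_pow, if_neg hi.symm]
  · intro hk'
    exact absurd (Finset.mem_range.2 (Nat.lt_succ_of_le hk)) hk'

theorem smul_mem_of_generators {W : Submodule ℂ V} (hh : ∀ v ∈ W, bh 0 • v ∈ W)
    (hp : ∀ v ∈ W, bxPlus 0 • v ∈ W) (hm : ∀ v ∈ W, bxMinusOne • v ∈ W) (x : UB) :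
    ∀ v ∈ W, x • v ∈ W := by
  obtain ⟨x, hx⟩ := x
  induction hx using Algebra.adjoin_induction with
  | mem x hx =>
    rcases hx with rfl | rfl | rfl
    · exact hh
    · exact hp
    · exact hm
  | algebraMap c =>
    intro v hv
    have h : algebraMap ℂ UB c • v ∈ W := by
      rw [algebraMap_smul]
      exact W.smul_mem c hv
    exact h
  | add x y hx hy ihx ihy =>
    intro v hv
    have h : ((⟨x, hx⟩ : UB) + ⟨y, hy⟩) • v ∈ W := by
      rw [add_smul]
      exact add_mem (ihx v hv) (ihy v hv)
    exact h
  | mul x y hx hy ihx ihy =>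
    intro v hv
    have h : ((⟨x, hx⟩ : UB) * ⟨y, hy⟩) • v ∈ W := by
      rw [mul_smul]
      exact ihx _ (ihy v hv)
    exact h

theorem smul_mem_VB (x : UB) : x • Ψ ∈ VB Ψ :=
  Submodule.smul_mem _ x (Submodule.mem_span_singleton_self Ψ)

end

end BorelLoop

end

/-! ### The basis of the sector -/

open BorelLoop in
theorem mainTheorem3 {V : Type*} [AddCommGroup V] [Module ℂ V] [Module BorelLoop.UB V]
    [IsScalarTower ℂ BorelLoop.UB V] (Ψ : V) (d : ℕ → ℂ)
    (hΨ : BorelLoop.IsHighestWeightVector d Ψ)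
    (hfin : FiniteDimensional ℂ (BorelLoop.VB Ψ))
    (r : ℕ) (hr : BorelLoop.IsNilpotentOfDegree Ψ r)
    (s : ℕ) (a : Fin s → ℂ) (m : Fin s → ℕ)
    (ha : BorelLoop.IsEvaluationParameters Ψ r a m)
    (hdistinct : ∀ k, m k = 1) (n : ℕ) :
    ∃ b : Module.Basis (Fin n ↪o Fin s) ℂ (BorelLoop.sector Ψ (d 0) n),
      ∀ j : Fin n ↪o Fin s,
        (b j : V) = (List.ofFn fun t => BorelLoop.rhoMinus a (j t)).prod • Ψ := by
  obtain ⟨ha, -, hsum, hfac⟩ := ha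
  obtain rfl : s = r := by simpa [hdistinct] using hsum
  simp only [hdistinct, pow_one] at hfac
  have hT := hΨ.isHighest
  have hd : polyLift d 1 = d 0 := by
    rw [← Polynomial.monomial_zero_one, polyLift_monomial, one_smul]
  have hw : ∀ k ≤ Fintype.card (Fin s), PowerSeries.coeff k
      (LoopTriple.weightSeries (polyLift d)) =
        PowerSeries.coeff k (LoopTriple.paramSeries a) := fun k hk =>
    coeff_weightSeries_eq hΨ hfac (by rwa [Fintype.card_fin] at hk)
  have hnil : borelTriple.F 1 ^ (Fintype.card (Fin s) + 1) • Ψ = 0 := by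
    rw [borelTriple_F_one, Fintype.card_fin]
    exact hr.1
  have hne : borelTriple.F 1 ^ Fintype.card (Fin s) • Ψ ≠ 0 := by
    rw [borelTriple_F_one, Fintype.card_fin]
    -- The nilpotency hypothesis gives nonvanishing only for positive exponents; for `s = 0` it is Ψ
    -- ≠ 0.
    rcases Nat.eq_zero_or_pos s with rfl | hs
    · rw [pow_zero, one_smul]
      exact hΨ.ne_zero
    · exact hr.2 s hs le_rfl
  have hF := LoopTriple.F_smul_eq_zero hT ha hnil hw
  have hsq := LoopTriple.F_sq_smul hT ha hF hnil hw
  -- The span contains Ψ (empty subset) and is stable under the three generators of U(B).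
  have hVB : ∀ v ∈ VB Ψ,
      v ∈ Submodule.span ℂ (Set.range fun S => borelTriple.rhoProd a S • Ψ) := by
    intro v hv
    obtain ⟨x, rfl⟩ := Submodule.mem_span_singleton.1 hv
    refine smul_mem_of_generators (fun v hv => ?_) (fun v hv => ?_) (fun v hv => ?_) x Ψ
      (Submodule.subset_span ⟨∅, ?_⟩)
    · rw [← borelTriple_H_one]
      exact LoopTriple.smul_mem_span_of_forall (LoopTriple.H_smul_mem_span hT hF 1) hv
    · exact LoopTriple.smul_mem_span_of_forall (LoopTriple.e_smul_mem_span hT ha hF hsq) hv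
    · rw [← borelTriple_F_one]
      exact LoopTriple.smul_mem_span_of_forall (LoopTriple.F_smul_mem_span ha hF hsq 1) hv
    · exact (congr_arg (· • Ψ) LoopTriple.rhoProd_empty).trans (one_smul _ _)
  have hcard : ∀ j : Fin n ↪o Fin s, (Finset.univ.map j.toEmbedding).card = n := fun j => by
    rw [Finset.card_map, Finset.card_univ, Fintype.card_fin]
  let w : (Fin n ↪o Fin s) → sector Ψ (d 0) n := fun j =>
    ⟨borelTriple.rhoProd a (Finset.univ.map j.toEmbedding) • Ψ, smul_mem_VB _, by
      rw [← borelTriple_H_one, LoopTriple.H_smul_rhoProd hT hF, hd]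
      simp⟩
  -- Both `j` and `j'` are the increasing enumeration of the same subset.
  have hinj : Function.Injective fun j : Fin n ↪o Fin s => Finset.univ.map j.toEmbedding := by
    intro j j' h
    refine (Finset.orderEmbOfFin_unique' (hcard j) fun t => ?_).trans
      (Finset.orderEmbOfFin_unique' (hcard j) fun t => ?_).symm
    · exact Finset.mem_map_of_mem j.toEmbedding (Finset.mem_univ t)
    · dsimp only at h
      rw [h]
      exact Finset.mem_map_of_mem j'.toEmbedding (Finset.mem_univ t)
  have hli : LinearIndependent ℂ w := by
    refine LinearIndependent.of_comp (sector Ψ (d 0) n).subtype ?_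
    exact (LoopTriple.linearIndependent_rhoProd ha hF hsq hne).comp _ hinj
  have hspan : ⊤ ≤ Submodule.span ℂ (Set.range w) := by
    rintro ⟨v, hv, hv'⟩ -
    rw [← borelTriple_H_one, ← hd] at hv'
    have h := LoopTriple.mem_span_of_weight hT ha hF hsq hne (hVB v hv) hv'
    have h2 : v ∈ (Submodule.span ℂ (Set.range w)).map (sector Ψ (d 0) n).subtype := by
      rw [Submodule.map_span]
      refine Submodule.span_mono ?_ h
      rintro _ ⟨S, hS, rfl⟩
      refine ⟨_, ⟨S.orderEmbOfFin hS, rfl⟩, ?_⟩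
      have h3 : Finset.univ.map (S.orderEmbOfFin hS).toEmbedding = S := by
        rw [← Finset.coe_inj, Finset.coe_map, Finset.coe_univ, Set.image_univ]
        exact Finset.range_orderEmbOfFin S hS
      exact congr_arg (fun S => borelTriple.rhoProd a S • Ψ) h3
    obtain ⟨y, hy, rfl⟩ := h2
    exact hy
  exact ⟨Module.Basis.mk hli hspan, fun j => by
    rw [Module.Basis.mk_apply, prod_ofFn_rhoMinus]⟩
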